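/- Let $a\in\mathbb{R}$. For $k=0,1,2,\dots$ put $$f_k(x)=\sum_{j=0}^{k}(k+1-j)\frac{x^j}{j!},$$ and define polynomials $$q_{2k}^{(\mathrm{pre})}(z)=\sum_{i=0}^{2k}\alpha_{2k,i}^{(\mathrm{pre})}z^i,\qquad q_{2k+1}^{(\mathrm{pre})}(z)=\sum_{i=0}^{2k+1}\beta_{2k+1,i}^{(\mathrm{pre})}z^i,$$ whose coefficients are \begin{align*} \alpha_{2k,2j}^{(\mathrm{pre})}&=\Big[\sum_{\ell=j}^{k}(\ell+1-j)\frac{(2k+3)!!}{(2\ell+3)!!}(2a^2)^{\ell-j}-\sum_{\ell=j}^{k}(\ell-j)\frac{(2k+1)!!}{(2\ell+1)!!}(2a^2)^{\ell-j}\Big]\frac{2^jf_j(a^2)}{2^kf_k(a^2)} &&(0\le j\le k),\\ \alpha_{2k,2j+1}^{(\mathrm{pre})}&=2a\Big[\sum_{\ell=j}^{k-1}(\ell+1-j)\frac{(2k+3)!!}{(2\ell+5)!!}(2a^2)^{\ell-j}-\sum_{\ell=j}^{k-1}(\ell-j)\frac{(2k+1)!!}{(2\ell+3)!!}(2a^2)^{\ell-j}\Big]\frac{2^jf_j(a^2)}{2^kf_k(a^2)}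 &&(0\le j\le k-1),\\ \beta_{2k+1,2j}^{(\mathrm{pre})}&=a\Big[\frac{2j+1}{2k+3}(2a^2)^{k-j}+2\sum_{\ell=j}^{k}(\ell+1-j)\frac{(2k+1)!!}{(2\ell+3)!!}(2a^2)^{\ell-j}\Big]\frac{2^jf_j(a^2)}{2^kf_k(a^2)} &&(0\le j\le k),\\ \beta_{2k+1,2j+1}^{(\mathrm{pre})}&=\Big[\frac{2j+3}{2k+3}(2a^2)^{k-j}+2\sum_{\ell=j}^{k}(\ell-j)\frac{(2k+1)!!}{(2\ell+3)!!}(2a^2)^{\ell-j}\Big]\frac{2^jf_j(a^2)}{2^kf_k(a^2)} &&(0\le j\le k), \end{align*} with the convention $(2a^2)^0=1$ also for $a=0$. Let $\omega^{(\mathrm{pre})}(z)=(1+|z-a|^2)e^{-2|z|^2}$ on $\mathbb{C}$, let $dA(z)=d^2z/\pi$, and consider the skew-product $$\langle f,g\rangle_s=\int_{\mathbb{C}}\big(f(z)\overline{g(z)}-g(z)\overline{f(z)}\big)(z-\overline{z})\,\omega^{(\mathrm{pre})}(z)\,dA(z).$$ Then each $q_n^{(\mathrm{pre})}$ is monic of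 degree $n$, and $\{q_n^{(\mathrm{pre})}\}_{n\ge 0}$ is a family of skew-orthogonal polynomials for this skew-product: all the integrals converge absolutely, and for all $k,\ell\ge 0$ $$\langle q_{2k}^{(\mathrm{pre})},q_{2\ell}^{(\mathrm{pre})}\rangle_s=\langle q_{2k+1}^{(\mathrm{pre})},q_{2\ell+1}^{(\mathrm{pre})}\rangle_s=0,\qquad \langle q_{2k}^{(\mathrm{pre})},q_{2\ell+1}^{(\mathrm{pre})}\rangle_s=-\langle q_{2\ell+1}^{(\mathrm{pre})},q_{2k}^{(\mathrm{pre})}\rangle_s=r_k^{(\mathrm{pre})}\,\delta_{k,\ell},$$ with the positive skew-norms $$r_k^{(\mathrm{pre})}=\frac{(2k+2)!}{2^{2k+2}}\,\frac{f_{k+1}(a^2)}{f_k(a^2)}>0 .$$ -/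

import Mathlib

open scoped Nat Polynomial

noncomputable section

namespace PreOverlap

/-- The area measure `dA(z) = d²z / π` on the complex plane. -/
def areaMeasure : MeasureTheory.Measure ℂ :=
  ENNReal.ofReal (Real.pi⁻¹) • MeasureTheory.volume

/-- The integrand, with respect to `dA`, of the skew-product of `f` and `g` for `dμ = w dA`. -/
def skewIntegrand (w : ℂ → ℝ) (f g : ℂ → ℂ) (z : ℂ) : ℂ :=
  (f z * starRingEnd ℂ (g z) - g z * starRingEnd ℂ (f z)) * (z - starRingEnd ℂ z) * (w z : ℂ)

/-- The skew-product `⟨f, g⟩_s = ∫ (f(z) conj(g(z)) - g(z) conj(f(z))) (z - conj z) w(z) dA(z)`. -/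
def skewProduct (w : ℂ → ℝ) (f g : ℂ → ℂ) : ℂ :=
  ∫ z, skewIntegrand w f g z ∂areaMeasure

/-- The family of polynomials `q` is a family of planar skew-orthogonal polynomials for the
weight `w`, with (positive) skew-norms `r`. All skew-products are genuine, absolutely convergent
integrals. -/
structure IsPlanarSOP (w : ℂ → ℝ) (q : ℕ → ℂ[X]) (r : ℕ → ℝ) : Prop where
  integrable : ∀ m n : ℕ, MeasureTheory.Integrable
    (skewIntegrand w (fun z => (q m).eval z) (fun z => (q n).eval z)) areaMeasure
  even_even : ∀ k l : ℕ,
    skewProduct w (fun z => (q (2 * k)).eval z) (fun z => (q (2 * l)).eval z) = 0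
  odd_odd : ∀ k l : ℕ,
    skewProduct w (fun z => (q (2 * k + 1)).eval z) (fun z => (q (2 * l + 1)).eval z) = 0
  even_odd : ∀ k l : ℕ,
    skewProduct w (fun z => (q (2 * k)).eval z) (fun z => (q (2 * l + 1)).eval z)
      = if k = l then (r k : ℂ) else 0
  odd_even : ∀ k l : ℕ,
    skewProduct w (fun z => (q (2 * l + 1)).eval z) (fun z => (q (2 * k)).eval z)
      = if k = l then -(r k : ℂ) else 0
  norm_pos : ∀ k : ℕ, 0 < r k

/-- The pre-overlap weight `(1 + |z - x|²) exp(-2 |z|²)`. -/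
def preWeight (x z : ℂ) : ℝ :=
  (1 + ‖z - x‖ ^ 2) * Real.exp (-2 * ‖z‖ ^ 2)

/-- `f_k(x) = ∑_{j=0}^{k} (k + 1 - j) x^j / j!`. -/
def fSum (k : ℕ) (x : ℝ) : ℝ :=
  ∑ j ∈ Finset.range (k + 1), ((k : ℝ) + 1 - (j : ℝ)) * x ^ j / (j ! : ℝ)

/-- The common factor `2^j f_j(a²) / (2^k f_k(a²))` of the coefficients. -/
def prefactor (a : ℝ) (k j : ℕ) : ℝ :=
  (2 ^ j * fSum j (a ^ 2)) / (2 ^ k * fSum k (a ^ 2))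

/-! In the four coefficients below the quotient `(2a²)^ℓ / (2a²)^j`, which only occurs for
`j ≤ ℓ`, is the monomial `(2a²)^(ℓ - j)`; this gives it its meaning at `a = 0`. -/

/-- The coefficient of `z^(2j)` in `q_{2k}`, for `j ≤ k`. -/
def alphaEven (a : ℝ) (k j : ℕ) : ℝ :=
  ((∑ l ∈ Finset.Icc j k, ((l : ℝ) + 1 - (j : ℝ)) *
        (((2 * k + 3)‼ : ℝ) / ((2 * l + 3)‼ : ℝ)) * (2 * a ^ 2) ^ (l - j))
    - ∑ l ∈ Finset.Icc j k, ((l : ℝ) - (j : ℝ)) *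
        (((2 * k + 1)‼ : ℝ) / ((2 * l + 1)‼ : ℝ)) * (2 * a ^ 2) ^ (l - j))
  * prefactor a k j

/-- The coefficient of `z^(2j+1)` in `q_{2k}`, for `j < k`; the sums run over `j ≤ ℓ ≤ k - 1`. -/
def alphaOdd (a : ℝ) (k j : ℕ) : ℝ :=
  2 * a *
  ((∑ l ∈ Finset.Ico j k, ((l : ℝ) + 1 - (j : ℝ)) *
        (((2 * k + 3)‼ : ℝ) / ((2 * l + 5)‼ : ℝ)) * (2 * a ^ 2) ^ (l - j))
    - ∑ l ∈ Finset.Ico j k, ((l : ℝ) - (j : ℝ)) *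
        (((2 * k + 1)‼ : ℝ) / ((2 * l + 3)‼ : ℝ)) * (2 * a ^ 2) ^ (l - j))
  * prefactor a k j

/-- The coefficient of `z^(2j)` in `q_{2k+1}`, for `j ≤ k`. -/
def betaEven (a : ℝ) (k j : ℕ) : ℝ :=
  a *
  ((2 * (j : ℝ) + 1) / (2 * (k : ℝ) + 3) * (2 * a ^ 2) ^ (k - j)
    + 2 * ∑ l ∈ Finset.Icc j k, ((l : ℝ) + 1 - (j : ℝ)) *
        (((2 * k + 1)‼ : ℝ) / ((2 * l + 3)‼ : ℝ)) * (2 * a ^ 2) ^ (l - j))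
  * prefactor a k j

/-- The coefficient of `z^(2j+1)` in `q_{2k+1}`, for `j ≤ k`. -/
def betaOdd (a : ℝ) (k j : ℕ) : ℝ :=
  ((2 * (j : ℝ) + 3) / (2 * (k : ℝ) + 3) * (2 * a ^ 2) ^ (k - j)
    + 2 * ∑ l ∈ Finset.Icc j k, ((l : ℝ) - (j : ℝ)) *
        (((2 * k + 1)‼ : ℝ) / ((2 * l + 3)‼ : ℝ)) * (2 * a ^ 2) ^ (l - j))
  * prefactor a k j

/-- `α_{2k,i}`, the coefficient of `z^i` in `q_{2k}`, for `i ≤ 2k`. -/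
def alphaPre (a : ℝ) (k i : ℕ) : ℝ :=
  if Even i then alphaEven a k (i / 2) else alphaOdd a k (i / 2)

/-- `β_{2k+1,i}`, the coefficient of `z^i` in `q_{2k+1}`, for `i ≤ 2k + 1`. -/
def betaPre (a : ℝ) (k i : ℕ) : ℝ :=
  if Even i then betaEven a k (i / 2) else betaOdd a k (i / 2)

/-- The polynomial `q_{2k}(z) = ∑_{i=0}^{2k} α_{2k,i} z^i`. -/
def qEven (a : ℝ) (k : ℕ) : ℂ[X] :=
  ∑ i ∈ Finset.range (2 * k + 1), Polynomial.C (alphaPre a k i : ℂ) * Polynomial.X ^ i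

/-- The polynomial `q_{2k+1}(z) = ∑_{i=0}^{2k+1} β_{2k+1,i} z^i`. -/
def qOdd (a : ℝ) (k : ℕ) : ℂ[X] :=
  ∑ i ∈ Finset.range (2 * k + 2), Polynomial.C (betaPre a k i : ℂ) * Polynomial.X ^ i

/-- The family `q_0, q_1, q_2, …`. -/
def qPre (a : ℝ) (n : ℕ) : ℂ[X] :=
  if Even n then qEven a (n / 2) else qOdd a (n / 2)

/-- The skew-norms `r_k = (2k+2)! / 2^(2k+2) * f_{k+1}(a²) / f_k(a²)`. -/
def rPre (a : ℝ) (k : ℕ) : ℝ :=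
  ((2 * k + 2)! : ℝ) / 2 ^ (2 * k + 2) * (fSum (k + 1) (a ^ 2) / fSum k (a ^ 2))

end PreOverlap

end

/-! The weight is a quadratic polynomial in `z` and `conj z` times a radial Gaussian. Rotational
symmetry kills every Gaussian moment with unequal exponents, so the skew-product of `z^i` and `z^n`
vanishes unless `1 ≤ |i - n| ≤ 2` (`skewMoment_eq`). Pairing a polynomial with `z^n` therefore
involves only four of its coefficients (`bandRow`).

By antisymmetry it suffices that `q_{2k}` annihilates `z^n` for `n ≤ 2k` (`bandRow_alphaPre`), that
`q_{2k+1}` annihilates `z^n` for `n < 2k` (`bandRow_betaTrunc`), and that `q_{2k}` paired with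
`z^(2k+1)` gives `r_k` (`bandRow_alphaPre_top`); both polynomials are monic.

Each coefficient is a bracket times a prefactor proportional to `2^j f_j(a²)`, up to simple
constants. The coefficients of `z^(2j+1)` and `z^(2j+2)` essentially share a bracket, those of
`z^(2j)` and `z^(2j+1)` share a prefactor. The three-term recurrence of the prefactors
(`prefactor_recurrence`) thus reduces every row equation to a three-term recurrence of the brackets
(`evenBracket_recurrence`, `oddBracket_recurrence`). -/

namespace PreOverlap

open MeasureTheory ComplexConjugate

/-! ### Moments of the Gaussian weight -/

/-- The monomial `z^p conj(z)^q` times the Gaussian `exp(-2|z|²)`. -/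
noncomputable def gaussMonomial (p q : ℕ) (z : ℂ) : ℂ :=
  z ^ p * conj z ^ q * (Real.exp (-2 * ‖z‖ ^ 2) : ℂ)

/-- The radial moment `∫ |z|^(2p) exp(-2|z|²) dA = p! / 2^(p+1)`. -/
noncomputable def gaussMoment (p : ℕ) : ℝ := (p ! : ℝ) / 2 ^ (p + 1)

lemma gaussMoment_succ (p : ℕ) : gaussMoment (p + 1) = gaussMoment p * (p + 1) / 2 := by
  unfold gaussMoment
  rw [Nat.factorial_succ]
  push_cast
  field_simp
  ring

lemma integral_norm_pow_mul_exp (n : ℕ) :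
    ∫ z : ℂ, ‖z‖ ^ n * Real.exp (-2 * ‖z‖ ^ 2) =
      Real.pi * (2 : ℝ) ^ (-((n : ℝ) + 2) / 2) * Real.Gamma (((n : ℝ) + 2) / 2) := by
  have h := Complex.integral_rpow_mul_exp_neg_mul_rpow (p := 2) (q := n) (b := 2)
    (by norm_num) (by linarith [(Nat.cast_nonneg n : (0 : ℝ) ≤ n)]) (by norm_num)
  rw [← show 2 * Real.pi / 2 = Real.pi by ring, ← h]
  refine integral_congr_ae (Filter.Eventually.of_forall fun z => ?_)
  simp only [Real.rpow_natCast, Real.rpow_two]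

lemma integrable_norm_pow_mul_exp (n : ℕ) :
    Integrable fun z : ℂ => ‖z‖ ^ n * Real.exp (-2 * ‖z‖ ^ 2) := by
  -- A non-integrable function has Bochner integral `0` by convention, so the positive closed form
  -- forces integrability.
  refine Integrable.of_integral_ne_zero ?_
  rw [integral_norm_pow_mul_exp]
  have := Real.Gamma_pos_of_pos (s := ((n : ℝ) + 2) / 2) (by positivity)
  have := Real.pi_pos
  positivity

lemma integrable_gaussMonomial_volume (p q : ℕ) : Integrable (gaussMonomial p q) := by
  refine (integrable_norm_pow_mul_exp (p + q)).mono' ?_ (Filter.Eventually.of_forall fun z => ?_)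
  · have : Continuous (gaussMonomial p q) := by
      unfold gaussMonomial
      fun_prop
    exact this.aestronglyMeasurable
  · simp only [gaussMonomial, norm_mul, norm_pow, RCLike.norm_conj, Complex.norm_real,
      Real.norm_eq_abs, Real.abs_exp, pow_add, le_refl]

lemma integrable_gaussMonomial (p q : ℕ) : Integrable (gaussMonomial p q) areaMeasure :=
  (integrable_gaussMonomial_volume p q).smul_measure ENNReal.ofReal_ne_top

lemma integral_gaussMonomial_self (p : ℕ) :
    ∫ z, gaussMonomial p p z = (Real.pi * gaussMoment p : ℝ) := by
  have h : ∀ z, gaussMonomial p p z = ((‖z‖ ^ (2 * p) * Real.exp (-2 * ‖z‖ ^ 2) : ℝ) : ℂ) := by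
    intro z
    simp only [gaussMonomial]
    rw [← mul_pow, Complex.mul_conj, Complex.normSq_eq_norm_sq, pow_mul]
    push_cast
    ring
  simp_rw [h]
  rw [integral_complex_ofReal, integral_norm_pow_mul_exp]
  congr 1
  have h1 : (((2 * p : ℕ) : ℝ) + 2) / 2 = (p : ℝ) + 1 := by push_cast; ring
  rw [neg_div, h1, Real.Gamma_nat_eq_factorial, Real.rpow_neg (by norm_num), ← Nat.cast_succ,
    Real.rpow_natCast, gaussMoment]
  field_simp

/-- The rotation by the angle `π / (p - q)` preserves Lebesgue measure and the Gaussian, and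
multiplies the monomial by `u^(p-q) = -1`; the integral equals its own negative. -/
lemma integral_gaussMonomial_of_lt {p q : ℕ} (h : q < p) : ∫ z, gaussMonomial p q z = 0 := by
  set u : Circle := Circle.exp (Real.pi / (p - q : ℕ)) with hu
  have hpq : ((p - q : ℕ) : ℂ) ≠ 0 := by
    have : p - q ≠ 0 := by omega
    exact_mod_cast this
  have hrot : (u : ℂ) ^ p * conj (u : ℂ) ^ q = -1 := by
    obtain ⟨d, rfl⟩ := Nat.exists_eq_add_of_lt h
    have h1 : (u : ℂ) ^ (q + d + 1 - q) = -1 := by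
      rw [hu, Circle.coe_exp, ← Complex.exp_nat_mul, ← Complex.exp_pi_mul_I]
      congr 1
      push_cast
      field_simp
    have h2 : (u : ℂ) * conj (u : ℂ) = 1 := by
      rw [Complex.mul_conj, Circle.normSq_coe]; simp
    rw [show q + d + 1 - q = d + 1 by omega] at h1
    rw [add_assoc, pow_add, h1, mul_neg_one, neg_mul, ← mul_pow, h2, one_pow]
  have hinv : ∀ z, gaussMonomial p q (rotation u z) = -gaussMonomial p q z := by
    intro z
    simp only [gaussMonomial, LinearIsometryEquiv.norm_map]
    rw [rotation_apply, map_mul, mul_pow, mul_pow]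
    linear_combination (z ^ p * conj z ^ q * (Real.exp (-2 * ‖z‖ ^ 2) : ℂ)) * hrot
  have key := (rotation u).measurePreserving.integral_comp
    (rotation u).toHomeomorph.measurableEmbedding (gaussMonomial p q)
  simp_rw [hinv] at key
  rw [integral_neg] at key
  exact self_eq_neg.mp key.symm

lemma conj_gaussMonomial (p q : ℕ) (z : ℂ) :
    conj (gaussMonomial p q z) = gaussMonomial q p z := by
  simp only [gaussMonomial, map_mul, map_pow, Complex.conj_conj, Complex.conj_ofReal]
  ring

lemma integral_gaussMonomial (p q : ℕ) :
    ∫ z, gaussMonomial p q z ∂areaMeasure = ((if p = q then gaussMoment p else 0 : ℝ) : ℂ) := by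
  rw [areaMeasure, integral_smul_measure, ENNReal.toReal_ofReal (by positivity)]
  rcases lt_trichotomy p q with h | rfl | h
  · simp_rw [← conj_gaussMonomial q p]
    rw [integral_conj, integral_gaussMonomial_of_lt h, if_neg h.ne]
    simp
  · rw [integral_gaussMonomial_self, if_pos rfl, Complex.real_smul, ← Complex.ofReal_mul,
      inv_mul_cancel_left₀ Real.pi_ne_zero]
  · rw [integral_gaussMonomial_of_lt h, if_neg h.ne']
    simp

/-! ### Moments of the pre-overlap weight -/

/-- The monomial `z^p conj(z)^q` times the pre-overlap weight, in terms of Gaussian monomials. -/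
noncomputable def weightedMonomial (a : ℝ) (p q : ℕ) (z : ℂ) : ℂ :=
  ((1 + a ^ 2 : ℝ) : ℂ) * gaussMonomial p q z + gaussMonomial (p + 1) (q + 1) z
    - (a : ℂ) * (gaussMonomial (p + 1) q z + gaussMonomial p (q + 1) z)

lemma weightedMonomial_eq (a : ℝ) (p q : ℕ) (z : ℂ) :
    weightedMonomial a p q z = z ^ p * conj z ^ q * (preWeight a z : ℂ) := by
  have h : ((‖z - a‖ ^ 2 : ℝ) : ℂ) = (z - a) * (conj z - a) := by
    rw [← Complex.normSq_eq_norm_sq, ← Complex.mul_conj, map_sub, Complex.conj_ofReal]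
  simp only [weightedMonomial, gaussMonomial, preWeight, Complex.ofReal_mul, Complex.ofReal_add, h]
  push_cast
  ring

lemma integrable_weightedMonomial (a : ℝ) (p q : ℕ) :
    Integrable (weightedMonomial a p q) areaMeasure :=
  (((integrable_gaussMonomial p q).const_mul _).add (integrable_gaussMonomial _ _)).sub
    (((integrable_gaussMonomial _ _).add (integrable_gaussMonomial _ _)).const_mul _)

/-- The moment `∫ z^p conj(z)^q dμ` of the pre-overlap weight. -/
noncomputable def preMoment (a : ℝ) (p q : ℕ) : ℝ :=
  (1 + a ^ 2) * (if p = q then gaussMoment p else 0)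
    + (if p = q then gaussMoment (p + 1) else 0)
    - a * ((if p + 1 = q then gaussMoment (p + 1) else 0) + if p = q + 1 then gaussMoment p else 0)

lemma integral_weightedMonomial (a : ℝ) (p q : ℕ) :
    ∫ z, weightedMonomial a p q z ∂areaMeasure = (preMoment a p q : ℂ) := by
  have i (p q : ℕ) := integrable_gaussMonomial p q
  simp only [weightedMonomial]
  rw [integral_sub, integral_add ((i _ _).const_mul _) (i _ _), integral_const_mul,
    integral_const_mul, integral_add (i _ _) (i _ _)]
  · simp only [integral_gaussMonomial, preMoment, add_left_inj]
    push_cast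
    rfl
  · exact ((i _ _).const_mul _).add (i _ _)
  · exact ((i _ _).add (i _ _)).const_mul _

lemma preMoment_comm (a : ℝ) (p q : ℕ) : preMoment a p q = preMoment a q p := by
  unfold preMoment
  rcases eq_or_ne p q with rfl | h
  · ring
  · simp only [h, h.symm, if_false]
    rw [add_comm (if p + 1 = q then _ else _)]
    congr 3
    · by_cases h' : p = q + 1
      · rw [if_pos h', if_pos h'.symm, h']
      · rw [if_neg h', if_neg (Ne.symm h')]
    · by_cases h' : p + 1 = q
      · rw [if_pos h', if_pos h'.symm, h']
      · rw [if_neg h', if_neg (Ne.symm h')]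

/-! ### The banded matrix of skew-moments -/

lemma skewIntegrand_monomial (a : ℝ) (m n : ℕ) :
    skewIntegrand (preWeight a) (fun z => z ^ m) (fun z => z ^ n) = fun z =>
      (weightedMonomial a (m + 1) n z - weightedMonomial a m (n + 1) z)
        - (weightedMonomial a (n + 1) m z - weightedMonomial a n (m + 1) z) := by
  funext z
  simp only [weightedMonomial_eq, skewIntegrand, map_pow]
  ring

lemma integrable_skewIntegrand_monomial (a : ℝ) (m n : ℕ) :
    Integrable (skewIntegrand (preWeight a) (fun z => z ^ m) (fun z => z ^ n)) areaMeasure := by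
  have i (p q : ℕ) := integrable_weightedMonomial a p q
  rw [skewIntegrand_monomial]
  exact ((i _ _).sub (i _ _)).sub ((i _ _).sub (i _ _))

/-- The skew-product of the monomials `z^m` and `z^n`. -/
noncomputable def skewMoment (a : ℝ) (m n : ℕ) : ℝ :=
  2 * (preMoment a (m + 1) n - preMoment a m (n + 1))

lemma skewProduct_monomial (a : ℝ) (m n : ℕ) :
    skewProduct (preWeight a) (fun z => z ^ m) (fun z => z ^ n) = (skewMoment a m n : ℂ) := by
  have i (p q : ℕ) := integrable_weightedMonomial a p q
  rw [skewProduct, skewIntegrand_monomial,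
    integral_sub, integral_sub (i _ _) (i _ _), integral_sub (i _ _) (i _ _)]
  · simp only [integral_weightedMonomial, skewMoment]
    rw [preMoment_comm a (n + 1) m, preMoment_comm a n (m + 1)]
    push_cast
    ring
  · exact (i _ _).sub (i _ _)
  · exact (i _ _).sub (i _ _)

/-- Moments of the weight vanish unless the exponents differ by at most one, which leaves `|i - n| ≤
2`; on the diagonal the two moments cancel by symmetry. -/
lemma skewMoment_eq (a : ℝ) (i n : ℕ) :
    skewMoment a i n =
      (if i + 1 = n then gaussMoment n * (n + 3 + 2 * a ^ 2) else 0)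
      - (if i + 2 = n then 2 * a * gaussMoment n else 0)
      - (if i = n + 1 then gaussMoment (n + 1) * (n + 4 + 2 * a ^ 2) else 0)
      + (if i = n + 2 then 2 * a * gaussMoment (n + 2) else 0) := by
  unfold skewMoment preMoment
  have h1 : gaussMoment (n + 1) = gaussMoment n * (n + 1) / 2 := gaussMoment_succ n
  have h2 : gaussMoment (n + 2) = gaussMoment (n + 1) * (n + 1 + 1) / 2 := by
    simpa using gaussMoment_succ (n + 1)
  have hcases : i + 2 = n ∨ i + 1 = n ∨ i = n ∨ i = n + 1 ∨ i = n + 2 ∨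
      i + 2 < n ∨ n + 2 < i := by omega
  rcases hcases with rfl | rfl | rfl | rfl | rfl | h | h <;>
    simp (disch := omega) only [if_true, if_neg] <;> push_cast at h1 h2 ⊢
  · ring
  · linear_combination 2 * h1
  · ring
  · linear_combination -2 * h2
  · ring
  · ring
  · ring

/-- The skew-product of `∑ b_i z^i` and `z^n`. -/
noncomputable def bandRow (a : ℝ) (b : ℕ → ℝ) (n : ℕ) : ℝ :=
  gaussMoment n / 2 *
    (-(4 * a * if 2 ≤ n then b (n - 2) else 0)
      + 2 * (n + 3 + 2 * a ^ 2) * (if 1 ≤ n then b (n - 1) else 0)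
      - (n + 1) * (n + 4 + 2 * a ^ 2) * b (n + 1) + a * (n + 1) * (n + 2) * b (n + 2))

/-- A row near the top reads `b` at indices beyond `N`; the vanishing of `b` there lets each
Kronecker delta be collapsed regardless of the summation range. -/
lemma sum_mul_skewMoment (a : ℝ) (b : ℕ → ℝ) (N n : ℕ) (hb : ∀ i, N ≤ i → b i = 0) :
    ∑ i ∈ Finset.range N, b i * skewMoment a i n = bandRow a b n := by
  have pick (c : ℕ) (v : ℝ) :
      ∑ i ∈ Finset.range N, b i * (if i = c then v else 0) = b c * v := by
    simp only [mul_ite, mul_zero, Finset.sum_ite_eq', Finset.mem_range]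
    split_ifs with h
    · rfl
    · rw [hb c (not_lt.mp h), zero_mul]
  have pick' (c : ℕ) (v : ℝ) : ∑ i ∈ Finset.range N, b i * (if i + c = n then v else 0)
      = (if c ≤ n then b (n - c) else 0) * v := by
    split_ifs with h
    · rw [← pick]
      refine Finset.sum_congr rfl fun i _ => ?_
      simp only [show i + c = n ↔ i = n - c by omega]
    · rw [zero_mul]
      refine Finset.sum_eq_zero fun i _ => ?_
      rw [if_neg (by omega), mul_zero]
  simp only [skewMoment_eq, mul_add, mul_sub, Finset.sum_add_distrib, Finset.sum_sub_distrib,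
    pick, pick']
  have h1 : gaussMoment (n + 1) = gaussMoment n * (n + 1) / 2 := gaussMoment_succ n
  have h2 : gaussMoment (n + 2) = gaussMoment (n + 1) * (n + 1 + 1) / 2 := by
    simpa using gaussMoment_succ (n + 1)
  rw [bandRow, h2, h1]
  ring

/-! ### Skew-products of polynomials with real coefficients -/

/-- The polynomial with the first `N` coefficients `b`, as a function. -/
noncomputable def realPoly (b : ℕ → ℝ) (N : ℕ) (z : ℂ) : ℂ :=
  ∑ i ∈ Finset.range N, (b i : ℂ) * z ^ i

lemma skewIntegrand_realPoly (w : ℂ → ℝ) (b c : ℕ → ℝ) (N K : ℕ) :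
    skewIntegrand w (realPoly b N) (realPoly c K) = fun z =>
      ∑ i ∈ Finset.range N, ∑ j ∈ Finset.range K,
        ((b i * c j : ℝ) : ℂ) * skewIntegrand w (fun z => z ^ i) (fun z => z ^ j) z := by
  funext z
  simp only [skewIntegrand, realPoly, map_sum, map_mul, Complex.conj_ofReal, map_pow]
  rw [Finset.sum_mul_sum, Finset.sum_mul_sum, Finset.sum_comm (s := Finset.range K),
    ← Finset.sum_sub_distrib, Finset.sum_mul, Finset.sum_mul]
  refine Finset.sum_congr rfl fun i _ => ?_
  rw [← Finset.sum_sub_distrib, Finset.sum_mul, Finset.sum_mul]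
  refine Finset.sum_congr rfl fun j _ => ?_
  push_cast
  ring

lemma integrable_skewIntegrand_realPoly (a : ℝ) (b c : ℕ → ℝ) (N K : ℕ) :
    Integrable (skewIntegrand (preWeight a) (realPoly b N) (realPoly c K)) areaMeasure := by
  rw [skewIntegrand_realPoly]
  exact integrable_finsetSum _ fun i _ => integrable_finsetSum _ fun j _ =>
    (integrable_skewIntegrand_monomial a i j).const_mul _

lemma skewProduct_realPoly (a : ℝ) (b c : ℕ → ℝ) (N K : ℕ) (hb : ∀ i, N ≤ i → b i = 0) :
    skewProduct (preWeight a) (realPoly b N) (realPoly c K) =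
      ((∑ j ∈ Finset.range K, c j * bandRow a b j : ℝ) : ℂ) := by
  rw [skewProduct, skewIntegrand_realPoly, integral_finsetSum _ fun i _ =>
    integrable_finsetSum _ fun j _ => (integrable_skewIntegrand_monomial a i j).const_mul _]
  have h (i : ℕ) : ∫ z, ∑ j ∈ Finset.range K, ((b i * c j : ℝ) : ℂ) *
      skewIntegrand (preWeight a) (fun z => z ^ i) (fun z => z ^ j) z ∂areaMeasure =
      ((∑ j ∈ Finset.range K, c j * (b i * skewMoment a i j) : ℝ) : ℂ) := by
    rw [integral_finsetSum _ fun j _ => (integrable_skewIntegrand_monomial a i j).const_mul _]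
    push_cast
    refine Finset.sum_congr rfl fun j _ => ?_
    rw [integral_const_mul, ← skewProduct, skewProduct_monomial]
    ring
  simp_rw [h]
  rw [← Complex.ofReal_sum, Finset.sum_comm]
  congr 1
  refine Finset.sum_congr rfl fun j _ => ?_
  rw [← Finset.mul_sum, sum_mul_skewMoment a b N j hb]

lemma skewProduct_neg (w : ℂ → ℝ) (f g : ℂ → ℂ) : skewProduct w g f = -skewProduct w f g := by
  rw [skewProduct, skewProduct, ← integral_neg]
  congr 1
  funext z
  simp only [skewIntegrand]
  ring

/-! ### The recurrence for `fSum` and the common factor of the coefficients -/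

/-- The truncated exponential series `∑_{j=0}^{k} x^j / j!`. -/
noncomputable def expSum (k : ℕ) (x : ℝ) : ℝ := ∑ j ∈ Finset.range (k + 1), x ^ j / (j ! : ℝ)

lemma fSum_succ_eq_add (k : ℕ) (x : ℝ) : fSum (k + 1) x = fSum k x + expSum (k + 1) x := by
  rw [fSum, fSum, expSum, Finset.sum_range_succ, Finset.sum_range_succ _ (k + 1), ← add_assoc,
    ← Finset.sum_add_distrib]
  congr 1
  · refine Finset.sum_congr rfl fun j _ => ?_
    push_cast
    ring
  · push_cast
    ring

lemma expSum_succ_sub (k : ℕ) (x : ℝ) :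
    ((k : ℝ) + 2) * (expSum (k + 2) x - expSum (k + 1) x)
      = x * (expSum (k + 1) x - expSum k x) := by
  have h1 : expSum (k + 2) x - expSum (k + 1) x = x ^ (k + 2) / ((k + 2)! : ℝ) := by
    rw [expSum, Finset.sum_range_succ, expSum]; ring
  have h2 : expSum (k + 1) x - expSum k x = x ^ (k + 1) / ((k + 1)! : ℝ) := by
    rw [expSum, Finset.sum_range_succ, expSum]; ring
  rw [h1, h2, Nat.factorial_succ (k + 1)]
  push_cast
  field_simp
  ring

/-- The weight `k + 2 - j` splits into `k + 2` and `j`, and `j x^j / j! = x · x^(j-1) / (j-1)!`. -/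
lemma fSum_succ_eq_sub (k : ℕ) (x : ℝ) :
    fSum (k + 1) x = ((k : ℝ) + 2) * expSum (k + 1) x - x * expSum k x := by
  induction k with
  | zero => simp [fSum, expSum, Finset.sum_range_succ]; ring
  | succ k ih =>
    rw [fSum_succ_eq_add, ih]
    push_cast
    linear_combination -expSum_succ_sub k x

/-- Both truncated exponentials are eliminated using the two expressions for `fSum`, as a first
difference and as a combination of `expSum`. -/
lemma fSum_recurrence (k : ℕ) (x : ℝ) :
    ((k : ℝ) + 2) * fSum (k + 2) x = (k + 3 + x) * fSum (k + 1) x - x * fSum k x := by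
  have h1 := fSum_succ_eq_add k x
  have h2 := fSum_succ_eq_add (k + 1) x
  have h3 := fSum_succ_eq_sub (k + 1) x
  push_cast at h3
  linear_combination ((k : ℝ) + 3) * h2 - h3 - x * h1

lemma fSum_pos (k : ℕ) {x : ℝ} (hx : 0 ≤ x) : 0 < fSum k x := by
  refine Finset.sum_pos' (fun j hj => ?_) ⟨0, by simp, by simp; positivity⟩
  have : (j : ℝ) ≤ k := by exact_mod_cast Nat.lt_succ_iff.mp (Finset.mem_range.mp hj)
  have : (0 : ℝ) ≤ k + 1 - j := by linarith
  positivity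

/-- This is the prefactor recurrence at `m = -1`, with `f_{-1} = 0`; it serves the rows `n = 0` and
`n = 1`. -/
lemma prefactor_one (a : ℝ) (k : ℕ) : prefactor a k 1 = (4 + 2 * a ^ 2) * prefactor a k 0 := by
  have h0 : fSum 0 (a ^ 2) = 1 := by simp [fSum]
  have h1 : fSum 1 (a ^ 2) = 2 + a ^ 2 := by simp [fSum, Finset.sum_range_succ]; norm_num
  rw [prefactor, prefactor, h0, h1]
  ring

lemma prefactor_recurrence (a : ℝ) (k m : ℕ) :
    ((m : ℝ) + 2) * prefactor a k (m + 2) =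
      (2 * m + 6 + 2 * a ^ 2) * prefactor a k (m + 1) - 4 * a ^ 2 * prefactor a k m := by
  simp only [prefactor]
  linear_combination 2 ^ (m + 2) / (2 ^ k * fSum k (a ^ 2)) * fSum_recurrence m (a ^ 2)

lemma prefactor_self (a : ℝ) (k : ℕ) : prefactor a k k = 1 :=
  div_self (mul_pos (by positivity) (fSum_pos k (sq_nonneg a))).ne'

/-! ### Truncated weighted power sums -/

/-- `∑_{l=j}^{k} c_l y^(l-j)`. -/
noncomputable def tailSum (c : ℕ → ℝ) (y : ℝ) (k j : ℕ) : ℝ :=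
  ∑ l ∈ Finset.Icc j k, c l * y ^ (l - j)

/-- `∑_{l=j}^{k} (l - j) c_l y^(l-j)`. -/
noncomputable def weightedTailSum (c : ℕ → ℝ) (y : ℝ) (k j : ℕ) : ℝ :=
  ∑ l ∈ Finset.Icc j k, ((l : ℝ) - j) * c l * y ^ (l - j)

section tailSum

variable (c : ℕ → ℝ) (y : ℝ) {k j : ℕ}

lemma tailSum_of_lt (h : k < j) : tailSum c y k j = 0 := by
  simp [tailSum, Finset.Icc_eq_empty_of_lt h]

lemma weightedTailSum_of_lt (h : k < j) : weightedTailSum c y k j = 0 := by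
  simp [weightedTailSum, Finset.Icc_eq_empty_of_lt h]

lemma tailSum_eq (h : j ≤ k) : tailSum c y k j = c j + y * tailSum c y k (j + 1) := by
  rw [tailSum, ← Finset.add_sum_Ioc_eq_sum_Icc h, tailSum, Finset.mul_sum, Nat.sub_self, pow_zero,
    mul_one, ← Finset.Icc_succ_left_eq_Ioc]
  refine congrArg _ (Finset.sum_congr rfl fun l hl => ?_)
  have hl := (Finset.mem_Icc.mp hl).1
  rw [show l - j = l - (j + 1) + 1 by omega, pow_succ]
  ring

lemma tailSum_self : tailSum c y k k = c k := by
  rw [tailSum_eq c y le_rfl, tailSum_of_lt c y k.lt_succ_self, mul_zero, add_zero]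

/-- The term `l = j` has weight zero, and elsewhere `l - j = (l - (j + 1)) + 1`. -/
lemma weightedTailSum_eq :
    weightedTailSum c y k j = y * (weightedTailSum c y k (j + 1) + tailSum c y k (j + 1)) := by
  rcases lt_or_ge k j with h | h
  · rw [weightedTailSum_of_lt c y h, weightedTailSum_of_lt c y (by omega),
      tailSum_of_lt c y (by omega)]
    ring
  rw [weightedTailSum, ← Finset.add_sum_Ioc_eq_sum_Icc h, weightedTailSum, tailSum,
    ← Finset.sum_add_distrib, Finset.mul_sum, ← Finset.Icc_succ_left_eq_Ioc]
  rw [sub_self, zero_mul, zero_mul, zero_add]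
  refine Finset.sum_congr rfl fun l hl => ?_
  have hl := (Finset.mem_Icc.mp hl).1
  rw [show l - j = l - (j + 1) + 1 by omega, pow_succ]
  push_cast
  ring

lemma weightedTailSum_self : weightedTailSum c y k k = 0 := by
  rw [weightedTailSum_eq, weightedTailSum_of_lt c y k.lt_succ_self,
    tailSum_of_lt c y k.lt_succ_self, add_zero, mul_zero]

end tailSum

/-- The quotient `(2k+3)‼ / (2l+3)‼`. -/
noncomputable def oddRatio (k l : ℕ) : ℝ := ((2 * k + 3)‼ : ℝ) / ((2 * l + 3)‼ : ℝ)

/-- The quotient `(2k+1)‼ / (2l+1)‼`. -/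
noncomputable def oddRatio' (k l : ℕ) : ℝ := ((2 * k + 1)‼ : ℝ) / ((2 * l + 1)‼ : ℝ)

lemma doubleFactorial_ne_zero (n : ℕ) : (n‼ : ℝ) ≠ 0 := by
  exact_mod_cast (Nat.doubleFactorial_pos n).ne'

lemma oddRatio_self (k : ℕ) : oddRatio k k = 1 := div_self (doubleFactorial_ne_zero _)

lemma oddRatio'_self (k : ℕ) : oddRatio' k k = 1 := div_self (doubleFactorial_ne_zero _)

lemma oddRatio_eq (k l : ℕ) : oddRatio k l = (2 * l + 5) * oddRatio k (l + 1) := by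
  have h := doubleFactorial_ne_zero (2 * l + 3)
  rw [oddRatio, oddRatio, show 2 * (l + 1) + 3 = 2 * l + 3 + 2 by ring,
    Nat.doubleFactorial_add_two (2 * l + 3)]
  push_cast
  field_simp
  ring

lemma oddRatio'_eq (k l : ℕ) : oddRatio' k l = (2 * l + 3) * oddRatio' k (l + 1) := by
  have h := doubleFactorial_ne_zero (2 * l + 1)
  rw [oddRatio', oddRatio', show 2 * (l + 1) + 1 = 2 * l + 1 + 2 by ring,
    Nat.doubleFactorial_add_two (2 * l + 1)]
  push_cast
  field_simp
  ring

/-! ### The brackets of the coefficients and their recurrences -/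

/-- The bracket in the coefficient of `z^(2j)` in `q_{2k}`. -/
noncomputable def evenBracket (y : ℝ) (k j : ℕ) : ℝ :=
  tailSum (oddRatio k) y k j + weightedTailSum (oddRatio k) y k j
    - weightedTailSum (oddRatio' k) y k j

/-- `2k + 3` times the bracket in the coefficient of `z^(2j)` in `q_{2k+1}`. -/
noncomputable def oddBracket (y : ℝ) (k j : ℕ) : ℝ :=
  (2 * j + 1) * y ^ (k - j)
    + 2 * (tailSum (oddRatio k) y k j + weightedTailSum (oddRatio k) y k j)

/-- `2k + 3` times the bracket in the coefficient of `z^(2j+1)` in `q_{2k+1}`. -/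
noncomputable def oddBracket' (y : ℝ) (k j : ℕ) : ℝ :=
  (2 * j + 3) * y ^ (k - j) + 2 * weightedTailSum (oddRatio k) y k j

lemma evenBracket_self (y : ℝ) (k : ℕ) : evenBracket y k k = 1 := by
  rw [evenBracket, tailSum_self, weightedTailSum_self, weightedTailSum_self, oddRatio_self]
  ring

lemma evenBracket_of_lt (y : ℝ) {k j : ℕ} (h : k < j) : evenBracket y k j = 0 := by
  rw [evenBracket, tailSum_of_lt _ _ h, weightedTailSum_of_lt _ _ h, weightedTailSum_of_lt _ _ h]
  ring

/-- This first-order difference removes the weighted sums, leaving only plain tail sums, which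
satisfy simple one-step relations. -/
lemma evenBracket_sub (y : ℝ) (k j : ℕ) :
    evenBracket y k j - y * evenBracket y k (j + 1)
      = tailSum (oddRatio k) y k j - y * tailSum (oddRatio' k) y k (j + 1) := by
  rw [evenBracket, weightedTailSum_eq, weightedTailSum_eq (oddRatio' k), evenBracket]
  ring

/-- Downward induction on `m` from `k - 1`. Writing `R m` for the left side and `D j` for `E j - y E
(j+1)` with `E` the bracket, one has `R m - y R (m+1) = D m - (2m+5+y) D (m+1) + (2m+5) y D (m+2)`.
By `evenBracket_sub` the right side consists of tail sums, which cancel by `tailSum_eq` and the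
one-step relations of the double factorial quotients. -/
lemma evenBracket_recurrence (y : ℝ) {k m : ℕ} (h : m < k) :
    evenBracket y k m - (2 * m + 5 + y) * evenBracket y k (m + 1)
      + (2 * m + 3) * y * evenBracket y k (m + 2) = 0 := by
  obtain ⟨n, hn⟩ := Nat.exists_eq_add_of_lt h
  induction n generalizing m with
  | zero =>
    obtain rfl : k = m + 1 := by omega
    have h1 := evenBracket_sub y (m + 1) m
    rw [tailSum_eq _ _ h.le, tailSum_self, tailSum_self, oddRatio'_self, oddRatio_eq,
      oddRatio_self, evenBracket_self] at h1
    rw [evenBracket_self, evenBracket_of_lt y (by omega : m + 1 < m + 2)]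
    linear_combination h1
  | succ n ih =>
    have ih := ih (m := m + 1) (by omega) (by omega)
    have e1 := evenBracket_sub y k m
    have e2 := evenBracket_sub y k (m + 1)
    have e3 := evenBracket_sub y k (m + 2)
    rw [tailSum_eq _ y h.le, tailSum_eq (oddRatio' k) y (by omega : m + 1 ≤ k)] at e1
    rw [tailSum_eq (oddRatio' k) y (by omega : m + 1 + 1 ≤ k)] at e2
    have c1 := oddRatio_eq k m
    have d1 := oddRatio'_eq k (m + 1)
    have p1 := tailSum_eq (oddRatio k) y (by omega : m + 1 ≤ k)
    have q1 := tailSum_eq (oddRatio' k) y (by omega : m + 2 ≤ k)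
    push_cast at *
    simp only [add_assoc, Nat.reduceAdd] at *
    linear_combination e1 + c1 - y * d1 - (2 * m + 5 + y) * e2 + (2 * m + 5) * y * e3 + y * ih
      - (2 * m + 5) * p1 - y ^ 2 * q1

lemma oddBracket_sub (y : ℝ) (k j : ℕ) :
    oddBracket y k j - oddBracket' y k j = 2 * tailSum (oddRatio k) y k j - 2 * y ^ (k - j) := by
  rw [oddBracket, oddBracket']
  ring

lemma oddBracket_self (y : ℝ) (k : ℕ) : oddBracket y k k = 2 * k + 3 := by
  rw [oddBracket, tailSum_self, weightedTailSum_self, oddRatio_self, Nat.sub_self]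
  ring

lemma oddBracket'_self (y : ℝ) (k : ℕ) : oddBracket' y k k = 2 * k + 3 := by
  rw [oddBracket', weightedTailSum_self, Nat.sub_self]
  ring

/-- Since `2j + 3 = 2(j + 1) + 1`, only a factor `y` has to be taken out of `y^(k-j)`, which
requires `j < k`. -/
lemma oddBracket'_eq (y : ℝ) {k j : ℕ} (h : j < k) :
    oddBracket' y k j = y * oddBracket y k (j + 1) := by
  rw [oddBracket', weightedTailSum_eq, oddBracket, show k - j = k - (j + 1) + 1 by omega]
  push_cast
  ring

/-- For `m + 1 < k` this is the recurrence of `evenBracket`, since `oddBracket'` at `m + 1` is then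
`y` times `oddBracket` at `m + 2`. The primed form also covers `m + 1 = k`. The downward induction
is the same, with `oddBracket_sub` supplying the first-order differences. -/
lemma oddBracket_recurrence (y : ℝ) {k m : ℕ} (h : m < k) :
    oddBracket y k m - (2 * m + 5 + y) * oddBracket y k (m + 1)
      + (2 * m + 3) * oddBracket' y k (m + 1) = 0 := by
  obtain ⟨n, hn⟩ := Nat.exists_eq_add_of_lt h
  induction n generalizing m with
  | zero =>
    obtain rfl : k = m + 1 := by omega
    have h1 := oddBracket_sub y (m + 1) m
    rw [oddBracket'_eq y h, tailSum_eq _ _ h.le, tailSum_self, oddRatio_eq, oddRatio_self,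
      oddBracket_self, show m + 1 - m = 1 by omega] at h1
    rw [oddBracket_self, oddBracket'_self]
    push_cast at *
    linear_combination h1
  | succ n ih =>
    have ih := ih (m := m + 1) (by omega) (by omega)
    have e1 := oddBracket_sub y k m
    have e2 := oddBracket_sub y k (m + 1)
    have e3 := oddBracket_sub y k (m + 2)
    rw [oddBracket'_eq y h, tailSum_eq _ y h.le, show k - m = k - (m + 2) + 2 by omega,
      pow_add] at e1
    have q1 := oddBracket'_eq y (by omega : m + 1 < k)
    rw [q1, show k - (m + 1) = k - (m + 2) + 1 by omega, pow_succ] at e2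
    have c1 := oddRatio_eq k m
    have p1 := tailSum_eq (oddRatio k) y (by omega : m + 1 ≤ k)
    push_cast at *
    simp only [add_assoc, Nat.reduceAdd] at *
    linear_combination e1 + 2 * c1 - (2 * m + 5 + y) * e2 + (2 * m + 5) * y * e3 + y * ih
      - 2 * (2 * m + 5) * p1 + (2 * m + 3) * q1

/-! ### The coefficients in terms of the brackets -/

lemma alphaEven_eq (a : ℝ) (k j : ℕ) :
    alphaEven a k j = evenBracket (2 * a ^ 2) k j * prefactor a k j := by
  rw [alphaEven, evenBracket, tailSum, weightedTailSum, weightedTailSum, ← Finset.sum_add_distrib]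
  congr 2
  refine Finset.sum_congr rfl fun l _ => ?_
  rw [oddRatio]
  ring

lemma sum_Ico_eq_sum_Icc_succ (g : ℕ → ℝ) (j k : ℕ) :
    ∑ l ∈ Finset.Ico j k, g (l + 1) = ∑ l ∈ Finset.Icc (j + 1) k, g l := by
  rw [Finset.sum_Ico_add' g j k 1, Finset.Ico_add_one_right_eq_Icc]

/-- Shifting `l` by one turns the bracket of `z^(2j+1)` into that of `z^(2j+2)`. -/
lemma alphaOdd_eq (a : ℝ) (k j : ℕ) :
    alphaOdd a k j = 2 * a * evenBracket (2 * a ^ 2) k (j + 1) * prefactor a k j := by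
  rw [alphaOdd, evenBracket, tailSum, weightedTailSum, weightedTailSum, ← Finset.sum_add_distrib,
    ← sum_Ico_eq_sum_Icc_succ, ← sum_Ico_eq_sum_Icc_succ]
  congr 3
  · refine Finset.sum_congr rfl fun l _ => ?_
    rw [oddRatio, Nat.add_sub_add_right, show 2 * (l + 1) + 3 = 2 * l + 5 by ring]
    push_cast
    ring
  · refine Finset.sum_congr rfl fun l _ => ?_
    rw [oddRatio', Nat.add_sub_add_right, show 2 * (l + 1) + 1 = 2 * l + 3 by ring]
    push_cast
    ring

lemma oddRatio_div (k l : ℕ) :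
    ((2 * k + 1)‼ : ℝ) / ((2 * l + 3)‼ : ℝ) = oddRatio k l / (2 * k + 3) := by
  have h := doubleFactorial_ne_zero (2 * l + 3)
  rw [oddRatio, show 2 * k + 3 = 2 * k + 1 + 2 by ring, Nat.doubleFactorial_add_two (2 * k + 1)]
  push_cast
  field_simp
  ring

lemma betaEven_eq (a : ℝ) (k j : ℕ) :
    betaEven a k j = a * (oddBracket (2 * a ^ 2) k j / (2 * k + 3)) * prefactor a k j := by
  have h : ∑ l ∈ Finset.Icc j k, ((l : ℝ) + 1 - (j : ℝ)) *
      (((2 * k + 1)‼ : ℝ) / ((2 * l + 3)‼ : ℝ)) * (2 * a ^ 2) ^ (l - j) =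
      (tailSum (oddRatio k) (2 * a ^ 2) k j + weightedTailSum (oddRatio k) (2 * a ^ 2) k j)
        / (2 * k + 3) := by
    rw [tailSum, weightedTailSum, ← Finset.sum_add_distrib, Finset.sum_div]
    refine Finset.sum_congr rfl fun l _ => ?_
    rw [oddRatio_div]
    ring
  rw [betaEven, h, oddBracket]
  ring

lemma betaOdd_eq (a : ℝ) (k j : ℕ) :
    betaOdd a k j = oddBracket' (2 * a ^ 2) k j / (2 * k + 3) * prefactor a k j := by
  have h : ∑ l ∈ Finset.Icc j k, ((l : ℝ) - (j : ℝ)) *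
      (((2 * k + 1)‼ : ℝ) / ((2 * l + 3)‼ : ℝ)) * (2 * a ^ 2) ^ (l - j) =
      weightedTailSum (oddRatio k) (2 * a ^ 2) k j / (2 * k + 3) := by
    rw [weightedTailSum, Finset.sum_div]
    refine Finset.sum_congr rfl fun l _ => ?_
    rw [oddRatio_div]
    ring
  rw [betaOdd, h, oddBracket']
  ring

lemma alphaPre_even (a : ℝ) (k j : ℕ) :
    alphaPre a k (2 * j) = evenBracket (2 * a ^ 2) k j * prefactor a k j := by
  rw [alphaPre, if_pos (even_two_mul j), Nat.mul_div_cancel_left _ two_pos, alphaEven_eq]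

lemma alphaPre_odd (a : ℝ) (k j : ℕ) :
    alphaPre a k (2 * j + 1) = 2 * a * evenBracket (2 * a ^ 2) k (j + 1) * prefactor a k j := by
  rw [alphaPre, if_neg (by simp), show (2 * j + 1) / 2 = j by omega, alphaOdd_eq]

lemma alphaPre_of_lt (a : ℝ) {k i : ℕ} (h : 2 * k < i) : alphaPre a k i = 0 := by
  obtain ⟨j, rfl | rfl⟩ := i.even_or_odd'
  · rw [alphaPre_even, evenBracket_of_lt _ (by omega), zero_mul]
  · rw [alphaPre_odd, evenBracket_of_lt _ (by omega), mul_zero, zero_mul]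

/-- The coefficients `β_{2k+1,i}`, extended by zero to `i > 2k + 1`. -/
noncomputable def betaTrunc (a : ℝ) (k i : ℕ) : ℝ := if i < 2 * k + 2 then betaPre a k i else 0

lemma betaTrunc_even (a : ℝ) {k j : ℕ} (h : j ≤ k) :
    betaTrunc a k (2 * j) =
      a * (oddBracket (2 * a ^ 2) k j / (2 * k + 3)) * prefactor a k j := by
  rw [betaTrunc, if_pos (by omega), betaPre, if_pos (even_two_mul j),
    Nat.mul_div_cancel_left _ two_pos, betaEven_eq]

lemma betaTrunc_odd (a : ℝ) {k j : ℕ} (h : j ≤ k) :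
    betaTrunc a k (2 * j + 1) = oddBracket' (2 * a ^ 2) k j / (2 * k + 3) * prefactor a k j := by
  rw [betaTrunc, if_pos (by omega), betaPre, if_neg (by simp), show (2 * j + 1) / 2 = j by omega,
    betaOdd_eq]

/-- The truncation matters: for `j > k` the exponent `k - j` is `0`, so the first summands of
`betaEven` and `betaOdd` survive, whereas the coefficients of `q_{2k}` vanish by themselves as empty
sums. -/
lemma betaTrunc_of_le (a : ℝ) {k i : ℕ} (h : 2 * k + 2 ≤ i) : betaTrunc a k i = 0 :=
  if_neg (by omega)

/-! ### Orthogonality to monomials -/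

lemma bandRow_zero (a : ℝ) (b : ℕ → ℝ) :
    bandRow a b 0 = gaussMoment 0 / 2 * (-((4 + 2 * a ^ 2) * b 1) + 2 * a * b 2) := by
  rw [bandRow, if_neg (by omega), if_neg (by omega)]
  push_cast
  ring

lemma bandRow_one (a : ℝ) (b : ℕ → ℝ) :
    bandRow a b 1 = gaussMoment 1 / 2 *
      (2 * (4 + 2 * a ^ 2) * b 0 - 2 * (5 + 2 * a ^ 2) * b 2 + 6 * a * b 3) := by
  rw [bandRow, if_neg (by omega), if_pos le_rfl]
  push_cast
  ring

lemma bandRow_add_two (a : ℝ) (b : ℕ → ℝ) (n : ℕ) :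
    bandRow a b (n + 2) = gaussMoment (n + 2) / 2 *
      (-(4 * a * b n) + 2 * (n + 5 + 2 * a ^ 2) * b (n + 1)
        - (n + 3) * (n + 6 + 2 * a ^ 2) * b (n + 3) + a * (n + 3) * (n + 4) * b (n + 4)) := by
  simp only [bandRow, Nat.add_sub_cancel, if_pos (by omega : 2 ≤ n + 2),
    if_pos (by omega : 1 ≤ n + 2), show n + 2 - 1 = n + 1 by omega]
  push_cast
  ring

/-- The two lowest coefficients in the row share a bracket, so the prefactor recurrence makes the
whole row proportional to `prefactor a k (m + 1)`. No bound on `m` is imposed, because the case `m =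
k` yields the skew-norm. -/
lemma bandRow_alphaPre_odd (a : ℝ) (k m : ℕ) :
    bandRow a (alphaPre a k) (2 * m + 1) =
      gaussMoment (2 * m + 1) * (m + 1) * prefactor a k (m + 1) *
        (evenBracket (2 * a ^ 2) k m - (2 * m + 5 + 2 * a ^ 2) * evenBracket (2 * a ^ 2) k (m + 1)
          + (2 * m + 3) * (2 * a ^ 2) * evenBracket (2 * a ^ 2) k (m + 2)) := by
  rcases m with _ | m
  · have e0 := alphaPre_even a k 0
    have e1 := alphaPre_even a k 1
    have e2 := alphaPre_odd a k 1
    norm_num at e0 e1 e2 ⊢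
    rw [bandRow_one, e0, e1, e2, prefactor_one]
    ring
  · have h := prefactor_recurrence a k m
    rw [show 2 * (m + 1) + 1 = 2 * m + 1 + 2 by ring, bandRow_add_two, alphaPre_odd,
      show 2 * m + 1 + 1 = 2 * (m + 1) by ring, show 2 * m + 1 + 3 = 2 * (m + 2) by ring,
      show 2 * m + 1 + 4 = 2 * (m + 2) + 1 by ring, alphaPre_even, alphaPre_even, alphaPre_odd]
    push_cast
    simp only [add_assoc, Nat.reduceAdd]
    linear_combination -gaussMoment (2 * m + 3) * evenBracket (2 * a ^ 2) k (m + 1) * h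

/-- Here the two highest coefficients share a bracket, and the prefactor recurrence reduces the row
to its lowest prefactor times the bracket recurrence. -/
lemma bandRow_alphaPre_even (a : ℝ) {k m : ℕ} (h : m ≤ k) :
    bandRow a (alphaPre a k) (2 * m) = 0 := by
  rcases m with _ | m
  · have e1 := alphaPre_odd a k 0
    have e2 := alphaPre_even a k 1
    norm_num at e1 e2 ⊢
    rw [bandRow_zero, e1, e2, prefactor_one]
    ring
  · have hp := prefactor_recurrence a k m
    have hr := evenBracket_recurrence (2 * a ^ 2) (by omega : m < k)
    rw [show 2 * (m + 1) = 2 * m + 2 by ring, bandRow_add_two, alphaPre_odd, alphaPre_even,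
      show 2 * m + 3 = 2 * (m + 1) + 1 by ring, show 2 * m + 4 = 2 * (m + 2) by ring,
      alphaPre_even, alphaPre_odd]
    push_cast
    simp only [add_assoc, Nat.reduceAdd]
    linear_combination gaussMoment (2 * m + 2) * a * (2 * m + 3) *
      evenBracket (2 * a ^ 2) k (m + 2) * hp
      - 2 * a * gaussMoment (2 * m + 2) * prefactor a k m * hr

lemma bandRow_alphaPre (a : ℝ) {k n : ℕ} (h : n ≤ 2 * k) : bandRow a (alphaPre a k) n = 0 := by
  obtain ⟨m, rfl | rfl⟩ := n.even_or_odd'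
  · exact bandRow_alphaPre_even a (by omega)
  · rw [bandRow_alphaPre_odd, evenBracket_recurrence _ (by omega), mul_zero]

/-- At `m = k` the bracket recurrence fails: only its first term, equal to `1`, is nonzero, and
`prefactor a k (k + 1) = 2 f_{k+1}(a²) / f_k(a²)` remains. -/
lemma bandRow_alphaPre_top (a : ℝ) (k : ℕ) :
    bandRow a (alphaPre a k) (2 * k + 1) = rPre a k := by
  rw [bandRow_alphaPre_odd, evenBracket_self, evenBracket_of_lt _ (by omega : k < k + 1),
    evenBracket_of_lt _ (by omega : k < k + 2), rPre, gaussMoment, prefactor,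
    Nat.factorial_succ (2 * k + 1)]
  push_cast
  rw [pow_succ (2 : ℝ) k, pow_succ (2 : ℝ) (2 * k + 1)]
  have := (fSum_pos k (sq_nonneg a)).ne'
  field_simp
  ring

/-- The same elimination as for `q_{2k}`, once `oddBracket'_eq` has exhibited the shared brackets.
-/
lemma bandRow_betaTrunc (a : ℝ) {k n : ℕ} (h : n < 2 * k) : bandRow a (betaTrunc a k) n = 0 := by
  obtain ⟨m, rfl | rfl⟩ := n.even_or_odd'
  · rcases m with _ | m
    · have e1 := betaTrunc_odd a (Nat.zero_le k)
      have e2 := betaTrunc_even a (by omega : 1 ≤ k)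
      norm_num at e1 e2 ⊢
      rw [bandRow_zero, e1, e2, prefactor_one, oddBracket'_eq _ (by omega)]
      ring
    · have hp := prefactor_recurrence a k m
      have hr := oddBracket_recurrence (2 * a ^ 2) (by omega : m < k)
      rw [oddBracket'_eq _ (by omega)] at hr
      rw [show 2 * (m + 1) = 2 * m + 2 by ring, bandRow_add_two, betaTrunc_odd a (by omega),
        betaTrunc_even a (by omega), show 2 * m + 3 = 2 * (m + 1) + 1 by ring,
        show 2 * m + 4 = 2 * (m + 2) by ring, betaTrunc_even a (by omega),
        betaTrunc_odd a (by omega), oddBracket'_eq _ (by omega), oddBracket'_eq _ (by omega)]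
      push_cast
      simp only [add_assoc, Nat.reduceAdd] at hr ⊢
      linear_combination gaussMoment (2 * m + 2) * a ^ 2 * (2 * m + 3) *
        oddBracket (2 * a ^ 2) k (m + 2) / (2 * k + 3) * hp
        - 2 * a ^ 2 * gaussMoment (2 * m + 2) * prefactor a k m / (2 * k + 3) * hr
  · have hr := oddBracket_recurrence (2 * a ^ 2) (by omega : m < k)
    rcases m with _ | m
    · have e0 := betaTrunc_even a (Nat.zero_le k)
      have e1 := betaTrunc_even a (by omega : 1 ≤ k)
      have e2 := betaTrunc_odd a (by omega : 1 ≤ k)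
      norm_num at e0 e1 e2 hr ⊢
      rw [bandRow_one, e0, e1, e2, prefactor_one]
      linear_combination gaussMoment 1 * a * (4 + 2 * a ^ 2) * prefactor a k 0 / (2 * k + 3) * hr
    · have hp := prefactor_recurrence a k m
      rw [show 2 * (m + 1) + 1 = 2 * m + 1 + 2 by ring, bandRow_add_two,
        betaTrunc_odd a (by omega), show 2 * m + 1 + 1 = 2 * (m + 1) by ring,
        show 2 * m + 1 + 3 = 2 * (m + 2) by ring, show 2 * m + 1 + 4 = 2 * (m + 2) + 1 by ring,
        betaTrunc_even a (by omega), betaTrunc_even a (by omega), betaTrunc_odd a (by omega),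
        oddBracket'_eq _ (by omega)]
      push_cast at hr ⊢
      simp only [add_assoc, Nat.reduceAdd] at hr ⊢
      linear_combination gaussMoment (2 * m + 3) * a * (m + 2) * prefactor a k (m + 2)
        / (2 * k + 3) * hr - gaussMoment (2 * m + 3) * a *
        oddBracket (2 * a ^ 2) k (m + 1) / (2 * k + 3) * hp

/-! ### The polynomials -/

lemma eval_sum_C_mul_X_pow (b : ℕ → ℝ) (N : ℕ) :
    (fun z => (∑ i ∈ Finset.range N,
      Polynomial.C (b i : ℂ) * Polynomial.X ^ i).eval z) = realPoly b N := by
  funext z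
  simp [realPoly, Polynomial.eval_finsetSum]

lemma eval_qPre_even (a : ℝ) (k : ℕ) :
    (fun z => (qPre a (2 * k)).eval z) = realPoly (alphaPre a k) (2 * k + 1) := by
  rw [qPre, if_pos (even_two_mul k), Nat.mul_div_cancel_left _ two_pos, qEven,
    eval_sum_C_mul_X_pow]

lemma eval_qPre_odd (a : ℝ) (k : ℕ) :
    (fun z => (qPre a (2 * k + 1)).eval z) = realPoly (betaTrunc a k) (2 * k + 2) := by
  rw [qPre, if_neg (by simp), show (2 * k + 1) / 2 = k by omega, qOdd, eval_sum_C_mul_X_pow]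
  funext z
  refine Finset.sum_congr rfl fun i hi => ?_
  rw [betaTrunc, if_pos (Finset.mem_range.mp hi)]

lemma natDegree_monic_sum (b : ℕ → ℂ) (n : ℕ) (h : b n = 1) :
    (∑ i ∈ Finset.range (n + 1), Polynomial.C (b i) * Polynomial.X ^ i : ℂ[X]).natDegree = n ∧
    (∑ i ∈ Finset.range (n + 1), Polynomial.C (b i) * Polynomial.X ^ i : ℂ[X]).Monic := by
  have hdeg : (∑ i ∈ Finset.range (n + 1),
      Polynomial.C (b i) * Polynomial.X ^ i : ℂ[X]).natDegree ≤ n :=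
    Polynomial.natDegree_sum_le_of_forall_le _ _ fun i hi =>
      (Polynomial.natDegree_C_mul_X_pow_le _ _).trans (Nat.lt_succ_iff.mp (Finset.mem_range.mp hi))
  have hcoeff : (∑ i ∈ Finset.range (n + 1),
      Polynomial.C (b i) * Polynomial.X ^ i : ℂ[X]).coeff n = 1 := by
    simp [Polynomial.coeff_X_pow, h]
  exact ⟨Polynomial.natDegree_eq_of_le_of_coeff_ne_zero hdeg (by rw [hcoeff]; exact one_ne_zero),
    Polynomial.monic_of_natDegree_le_of_coeff_eq_one n hdeg hcoeff⟩

lemma alphaPre_top (a : ℝ) (k : ℕ) : alphaPre a k (2 * k) = 1 := by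
  rw [alphaPre_even, evenBracket_self, prefactor_self, one_mul]

lemma betaTrunc_top (a : ℝ) (k : ℕ) : betaTrunc a k (2 * k + 1) = 1 := by
  rw [betaTrunc_odd a le_rfl, oddBracket'_self, prefactor_self, mul_one]
  exact div_self (by positivity)

lemma qPre_natDegree_monic (a : ℝ) (n : ℕ) : (qPre a n).natDegree = n ∧ (qPre a n).Monic := by
  obtain ⟨k, rfl | rfl⟩ := n.even_or_odd'
  · rw [qPre, if_pos (even_two_mul k), Nat.mul_div_cancel_left _ two_pos, qEven]
    exact natDegree_monic_sum (fun i => (alphaPre a k i : ℂ)) _ (by simp [alphaPre_top])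
  · rw [qPre, if_neg (by simp), show (2 * k + 1) / 2 = k by omega, qOdd]
    refine natDegree_monic_sum (fun i => (betaPre a k i : ℂ)) _ ?_
    have h := betaTrunc_top a k
    rw [betaTrunc, if_pos (by omega)] at h
    simp [h]

/-! ### Skew-orthogonality -/

lemma skewProduct_qPre_even (a : ℝ) {k K : ℕ} (c : ℕ → ℝ) (h : K ≤ 2 * k + 1) :
    skewProduct (preWeight a) (fun z => (qPre a (2 * k)).eval z) (realPoly c K) = 0 := by
  rw [eval_qPre_even, skewProduct_realPoly _ _ _ _ _ fun i hi => alphaPre_of_lt a (by omega),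
    Finset.sum_eq_zero, Complex.ofReal_zero]
  intro j hj
  rw [bandRow_alphaPre a (by have := Finset.mem_range.mp hj; omega), mul_zero]

lemma skewProduct_qPre_odd (a : ℝ) {k K : ℕ} (c : ℕ → ℝ) (h : K ≤ 2 * k) :
    skewProduct (preWeight a) (fun z => (qPre a (2 * k + 1)).eval z) (realPoly c K) = 0 := by
  rw [eval_qPre_odd, skewProduct_realPoly _ _ _ _ _ fun i hi => betaTrunc_of_le a hi,
    Finset.sum_eq_zero, Complex.ofReal_zero]
  intro j hj
  rw [bandRow_betaTrunc a (by have := Finset.mem_range.mp hj; omega), mul_zero]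

lemma skewProduct_qPre_even_even (a : ℝ) (k l : ℕ) :
    skewProduct (preWeight a) (fun z => (qPre a (2 * k)).eval z)
      (fun z => (qPre a (2 * l)).eval z) = 0 := by
  rcases le_total l k with h | h
  · rw [eval_qPre_even a l, skewProduct_qPre_even a _ (by omega)]
  · rw [skewProduct_neg, eval_qPre_even a k, skewProduct_qPre_even a _ (by omega), neg_zero]

lemma skewProduct_qPre_odd_odd (a : ℝ) (k l : ℕ) :
    skewProduct (preWeight a) (fun z => (qPre a (2 * k + 1)).eval z)
      (fun z => (qPre a (2 * l + 1)).eval z) = 0 := by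
  rcases lt_trichotomy l k with h | rfl | h
  · rw [eval_qPre_odd a l, skewProduct_qPre_odd a _ (by omega)]
  -- The rows `2k` and `2k + 1` of `q_{2k+1}` are not covered by `bandRow_betaTrunc`; on the
  -- diagonal antisymmetry alone suffices.
  · exact self_eq_neg.mp (skewProduct_neg _ _ _)
  · rw [skewProduct_neg, eval_qPre_odd a k, skewProduct_qPre_odd a _ (by omega), neg_zero]

lemma skewProduct_qPre_even_odd (a : ℝ) (k l : ℕ) :
    skewProduct (preWeight a) (fun z => (qPre a (2 * k)).eval z)
      (fun z => (qPre a (2 * l + 1)).eval z) = if k = l then (rPre a k : ℂ) else 0 := by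
  rcases lt_trichotomy l k with h | rfl | h
  · rw [if_neg h.ne', eval_qPre_odd a l, skewProduct_qPre_even a _ (by omega)]
  -- Only the leading coefficient `1` of the odd polynomial meets a nonzero row.
  · rw [if_pos rfl, eval_qPre_even, eval_qPre_odd,
      skewProduct_realPoly _ _ _ _ _ fun i hi => alphaPre_of_lt a (by omega),
      Finset.sum_range_succ, Finset.sum_eq_zero, bandRow_alphaPre_top, betaTrunc_top, zero_add,
      one_mul]
    intro j hj
    rw [bandRow_alphaPre a (by have := Finset.mem_range.mp hj; omega), mul_zero]
  · rw [if_neg h.ne, skewProduct_neg, eval_qPre_even a k, skewProduct_qPre_odd a _ (by omega),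
      neg_zero]

lemma rPre_pos (a : ℝ) (k : ℕ) : 0 < rPre a k := by
  have h1 := fSum_pos k (sq_nonneg a)
  have h2 := fSum_pos (k + 1) (sq_nonneg a)
  unfold rPre
  positivity

lemma exists_eval_qPre_eq_realPoly (a : ℝ) (n : ℕ) :
    ∃ b N, (fun z => (qPre a n).eval z) = realPoly b N := by
  obtain ⟨k, rfl | rfl⟩ := n.even_or_odd'
  · exact ⟨_, _, eval_qPre_even a k⟩
  · exact ⟨_, _, eval_qPre_odd a k⟩

lemma isPlanarSOP_qPre (a : ℝ) : IsPlanarSOP (preWeight a) (qPre a) (rPre a) where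
  integrable m n := by
    obtain ⟨b, N, hb⟩ := exists_eval_qPre_eq_realPoly a m
    obtain ⟨c, K, hc⟩ := exists_eval_qPre_eq_realPoly a n
    rw [hb, hc]
    exact integrable_skewIntegrand_realPoly a b c N K
  even_even := skewProduct_qPre_even_even a
  odd_odd := skewProduct_qPre_odd_odd a
  even_odd := skewProduct_qPre_even_odd a
  odd_even k l := by
    rw [skewProduct_neg, skewProduct_qPre_even_odd]
    split_ifs <;> simp
  norm_pos := rPre_pos a

end PreOverlap

theorem theorem2p3 (a : ℝ) :
    (∀ n : ℕ, (PreOverlap.qPre a n).natDegree = n ∧ (PreOverlap.qPre a n).Monic) ∧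
    PreOverlap.IsPlanarSOP (PreOverlap.preWeight (a : ℂ)) (PreOverlap.qPre a)
      (PreOverlap.rPre a) :=
  ⟨PreOverlap.qPre_natDegree_monic a, PreOverlap.isPlanarSOP_qPre a⟩
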